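/- Let $d\ge 0$ and let $\pi$ be a Borel probability measure on $\mathbb R^d$ (Euclidean norm) with compact support $K$. Assume that $\pi$ is doubling: there is $C>0$ such that $\pi(B(x,2r))\le C\,\pi(B(x,r))$ for all $x\in K$ and all $r>0$. Here $B(x,r)$ denotes the open ball. For $E\subset K$, $q\in\mathbb R$ and $r>0$ let $$\mathbf N_\pi^q(E,r)=\inf\sum_i \pi\big(B(x_i,r)\big)^q,$$ where the infimum is over all covers $(B(x_i,r))_i$ of $E$ by balls of radius $r$ with centres $x_i\in K$, and let $$\overline{\dim}_{\pi,B}^q(E)=\limsup_{r\to 0^+}\frac{\log \mathbf N_\pi^q(E,r)}{-\log r}\in[-\infty,+\infty].$$ For $F\subset K$ put $$\overline{\dim}_{\pi,B,\mathrm{loc}}^q(F)=\inf_{x\in F}\inf_{r>0}\overline{\dim}_{\pi,B}^q\big(F\cap B(x,r)\big),$$ and define the local upper moment scaling and the maximal local upper moment scaling of $\pi$ by $$\tau_{\pi,\mathrm{loc}}(q)=\overline{\dim}_{\pi,B,\mathrm{loc}}^q(K),\qquad \tau_{\pi,\mathrm{loc,max}}(q)=\sup_{y\in K,\ \rho>0}\overline{\dim}_{\pi,B,\mathrm{loc}}^q\big(K\cap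 B(y,\rho)\big).$$ Let $\mathcal P(K)$ be the set of Borel probability measures on $K$ with the weak topology. For $\mu\in\mathcal P(K)$ define the small and the big upper multifractal box dimension of $\mu$ of order $q$ by $$\overline{\dim}^{q}_{*,\pi,B}(\mu)=\inf_{\mu(E)>0}\overline{\dim}_{\pi,B}^q(E),\qquad \overline{\dim}^{*,q}_{\pi,B}(\mu)=\lim_{\varepsilon\to0^+}\ \inf_{\mu(E)>1-\varepsilon}\overline{\dim}_{\pi,B}^q(E),$$ where $E$ ranges over the Borel subsets of $K$. Then a typical $\mu\in\mathcal P(K)$ satisfies, simultaneously for all $q\in\mathbb R$, $$\overline{\dim}^{q}_{*,\pi,B}(\mu)=\tau_{\pi,\mathrm{loc}}(q)\qquad\text{and}\qquad \overline{\dim}^{*,q}_{\pi,B}(\mu)=\tau_{\pi,\mathrm{loc,max}}(q),$$ that is, there is a dense $G_\delta$ set $\mathcal R\subset\mathcal P(K)$ such that every $\mu\in\mathcal R$ satisfies both equalities for every $q\in\mathbb R$. -/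

import Mathlib

open MeasureTheory Filter Topology
open scoped NNReal ENNReal

noncomputable section

namespace MultifractalBox

variable {d : ℕ}

/-- A Borel measure `π` on `ℝ^d` is doubling if
`sup_{x ∈ supp π} sup_{r > 0} π(B(x,2r)) / π(B(x,r))` is finite. The denominators are positive
on the support, so the bound is written in product form. -/
def IsDoubling (π : Measure (EuclideanSpace ℝ (Fin d))) : Prop :=
  ∃ C : ℝ≥0, ∀ x ∈ π.support, ∀ r : ℝ, 0 < r →
    π (Metric.ball x (2 * r)) ≤ C * π (Metric.ball x r)

/-- The multifractal covering number `N_π^q(E, r)`: the infimum of `∑ π(B(x_i, r))^q` over all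
covers of `E` by balls of radius `r` with centres `x_i` in the support of `π`.
A cover is given by its set of centres. -/
def coveringSum (π : Measure (EuclideanSpace ℝ (Fin d))) (q : ℝ)
    (E : Set (EuclideanSpace ℝ (Fin d))) (r : ℝ) : ℝ≥0∞ :=
  ⨅ (s : Set (EuclideanSpace ℝ (Fin d))) (_ : s ⊆ π.support)
    (_ : E ⊆ ⋃ x ∈ s, Metric.ball x r), ∑' x : s, (π (Metric.ball (x : _) r)) ^ q

/-- The upper covering multifractal box dimension of `E` of order `q` with respect to `π`:
`limsup_{r → 0, r > 0} log N_π^q(E, r) / (- log r)`, as an extended real number. -/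
def upperDim (π : Measure (EuclideanSpace ℝ (Fin d))) (q : ℝ)
    (E : Set (EuclideanSpace ℝ (Fin d))) : EReal :=
  limsup (fun r : ℝ => ENNReal.log (coveringSum π q E r) / ((-Real.log r : ℝ) : EReal))
    (𝓝[>] (0 : ℝ))

/-- The local upper multifractal box dimension of `F` of order `q` with respect to `π`:
`inf_{x ∈ F} inf_{r > 0}` of the upper dimension of `F ∩ B(x, r)`. -/
def localUpperDim (π : Measure (EuclideanSpace ℝ (Fin d))) (q : ℝ)
    (F : Set (EuclideanSpace ℝ (Fin d))) : EReal :=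
  ⨅ x ∈ F, ⨅ (r : ℝ) (_ : 0 < r), upperDim π q (F ∩ Metric.ball x r)

/-- The local upper moment scaling `τ_{π,loc}(q)`. -/
def tauLoc (π : Measure (EuclideanSpace ℝ (Fin d))) (q : ℝ) : EReal :=
  localUpperDim π q π.support

/-- The maximal local upper moment scaling `τ_{π,loc,max}(q)`. -/
def tauLocMax (π : Measure (EuclideanSpace ℝ (Fin d))) (q : ℝ) : EReal :=
  ⨆ y ∈ π.support, ⨆ (ρ : ℝ) (_ : 0 < ρ), localUpperDim π q (π.support ∩ Metric.ball y ρ)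

/-- The small upper multifractal box dimension of `μ ∈ P(K)`, where `K = supp π`:
the infimum of the upper dimension of `E` over Borel sets `E ⊆ K` with `μ(E) > 0`. -/
def smallUpperDim (π : Measure (EuclideanSpace ℝ (Fin d))) (q : ℝ)
    (μ : ProbabilityMeasure π.support) : EReal :=
  ⨅ (E : Set π.support) (_ : MeasurableSet E) (_ : 0 < μ E), upperDim π q (Subtype.val '' E)

/-- The infimum of the upper dimension of `E` over Borel sets `E ⊆ K` with `μ(E) > 1 - ε`. -/
def upperDimUpTo (π : Measure (EuclideanSpace ℝ (Fin d))) (q : ℝ)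
    (μ : ProbabilityMeasure π.support) (ε : ℝ) : EReal :=
  ⨅ (E : Set π.support) (_ : MeasurableSet E) (_ : 1 - ε < (μ E : ℝ)),
    upperDim π q (Subtype.val '' E)

/-- The big upper multifractal box dimension of `μ ∈ P(K)`: the limit of `upperDimUpTo π q μ ε`
as `ε` decreases to `0`. This quantity increases as `ε` decreases, so the limit is the supremum
over `ε > 0`; see `tendsto_upperDimUpTo`. -/
def bigUpperDim (π : Measure (EuclideanSpace ℝ (Fin d))) (q : ℝ)
    (μ : ProbabilityMeasure π.support) : EReal :=
  ⨆ (ε : ℝ) (_ : 0 < ε), upperDimUpTo π q μ ε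

theorem antitone_upperDimUpTo (π : Measure (EuclideanSpace ℝ (Fin d))) (q : ℝ)
    (μ : ProbabilityMeasure π.support) : Antitone (upperDimUpTo π q μ) := by
  intro a b hab
  refine le_iInf fun E => le_iInf fun hE => le_iInf fun h => ?_
  exact iInf_le_of_le E (iInf_le_of_le hE (iInf_le_of_le (by linarith) le_rfl))

theorem tendsto_upperDimUpTo (π : Measure (EuclideanSpace ℝ (Fin d))) (q : ℝ)
    (μ : ProbabilityMeasure π.support) :
    Tendsto (upperDimUpTo π q μ) (𝓝[>] (0 : ℝ)) (𝓝 (bigUpperDim π q μ)) := by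
  have h := (antitone_upperDimUpTo π q μ).tendsto_nhdsGT (0 : ℝ)
  rwa [sSup_image] at h

end MultifractalBox

end

/-!
Write `K` for the support of `π`. As `K` is compact, so is the space of probability measures on `K`,
and Baire's theorem applies; a property is typical if it holds on a residual set. The doubling
condition makes `q ↦ upperDim π q E` Lipschitz with a constant independent of `E`
(`IsDoubling.exists_upperDim_le_add`), and the Lipschitz bound passes to all four quantities in the
theorem. Rational `q`, and rational thresholds `t` for the dimension, are therefore enough, and it
remains to find countably many typical properties that give the two equalities.

A typical measure charges every nonempty open set, which gives `smallUpperDim ≤ tauLoc`. It also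
gives full mass to a prescribed dense open set. For `t > tauLocMax π q` the points having a ball of
dimension less than `t` around them (`thinSet`) form a dense open set; finitely many such balls
carry mass `1 - ε`, and the dimension of a finite union is the maximum of the dimensions, so
`bigUpperDim ≤ tauLocMax`.

The lower bounds rest on `eventually_residual_le_upperDim`: for a typical `μ`, every set that meets
the open set `persistentSet π q t` in positive measure has dimension at least `t`. The persistent
set is all of `K` if `t < tauLoc π q`, and it is nonempty if `t < tauLocMax π q`. To prove the
property, take a ball of dimension more than `t` and a small scale at which its covering sum is
large. The masses `π(B(y, r)) ^ q` at the points `y` of a maximal separated subset, normalised,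
form a measure for which any set of mass more than `δ` has a large covering sum at that scale
(`exists_evenly_spread_measure`). Mixtures of such measures are weakly dense, and the conclusion is
stable under small perturbations in the Lévy–Prokhorov metric (`dense_interior_of_local_witness`).
The components of a mixture live at different scales, which is harmless because a limsup requires
just one favourable scale below each threshold.
-/

namespace MultifractalBox

/-! ### Typical measures in the weak topology -/

section WeakTopology

variable {X : Type*} [MetricSpace X] [MeasurableSpace X] [BorelSpace X]

/-- Weakly close measures are close for the Lévy–Prokhorov metric. -/
theorem eventually_measure_le_thickening [TopologicalSpace.SeparableSpace X]
    (ν : ProbabilityMeasure X) {ε : ℝ} (hε : 0 < ε) :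
    ∀ᶠ μ : ProbabilityMeasure X in 𝓝 ν, ∀ B, MeasurableSet B →
      (μ : Measure X) B ≤ (ν : Measure X) (Metric.thickening ε B) + ENNReal.ofReal ε ∧
      (ν : Measure X) B ≤ (μ : Measure X) (Metric.thickening ε B) + ENNReal.ofReal ε := by
  have hε' : 0 < ENNReal.ofReal ε := ENNReal.ofReal_pos.mpr hε
  have h := (LevyProkhorov.continuous_ofMeasure_probabilityMeasure (Ω := X)).tendsto ν
    (Metric.eball_mem_nhds _ hε')
  filter_upwards [h] with μ hμ B hB
  have hlt : levyProkhorovEDist (μ : Measure X) (ν : Measure X) < ENNReal.ofReal ε := hμ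
  have h1 := left_measure_le_of_levyProkhorovEDist_lt hlt hB
  have h2 := right_measure_le_of_levyProkhorovEDist_lt hlt hB
  rw [ENNReal.toReal_ofReal hε.le] at h1 h2
  exact ⟨h1, h2⟩

/-- For probability measures, one of the two inequalities defining the Lévy–Prokhorov distance
implies the other, so a one-sided bound suffices for weak approximation. -/
theorem mem_closure_of_forall_measure_le_thickening {S : Set (ProbabilityMeasure X)}
    {μ : ProbabilityMeasure X}
    (h : ∀ ε : ℝ, 0 < ε → ∃ ν ∈ S, ∀ B, MeasurableSet B →
      (μ : Measure X) B ≤ (ν : Measure X) (Metric.thickening ε B) + ENNReal.ofReal ε) :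
    μ ∈ closure S := by
  rw [mem_closure_iff_nhds]
  intro V hV
  have hV' := (LevyProkhorov.continuous_toMeasure_probabilityMeasure (Ω := X)).tendsto
    (LevyProkhorov.ofMeasure μ) hV
  obtain ⟨ε, hε, hb⟩ := Metric.mem_nhds_iff.mp hV'
  obtain ⟨ν, hν, hB⟩ := h (ε / 2) (by positivity)
  refine ⟨ν, ?_, hν⟩
  have : LevyProkhorov.ofMeasure ν ∈ Metric.ball (LevyProkhorov.ofMeasure μ) ε := by
    rw [Metric.mem_ball']
    have hle : levyProkhorovDist (μ : Measure X) (ν : Measure X) ≤ ε / 2 := by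
      refine levyProkhorovDist_le_of_forall_le _ _ (by positivity) fun ε' B hε' hBm => ?_
      refine (hB B hBm).trans ?_
      gcongr
    exact lt_of_le_of_lt hle (by linarith)
  exact hb this

theorem eventually_pos_and_ofReal_lt {δ : ℝ≥0∞} (hδ : 0 < δ) :
    ∀ᶠ r : ℝ in 𝓝[>] 0, 0 < r ∧ ENNReal.ofReal r < δ := by
  have h : Tendsto ENNReal.ofReal (𝓝[>] 0) (𝓝 0) := by
    simpa using (ENNReal.tendsto_ofReal (tendsto_id (α := ℝ) (x := 𝓝 0))).mono_left
      nhdsWithin_le_nhds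
  filter_upwards [h (Iio_mem_nhds hδ), self_mem_nhdsWithin] with r h1 h2 using ⟨h2, h1⟩

theorem exists_simpleFunc_dist_lt [CompactSpace X] [Nonempty X] {η : ℝ} (hη : 0 < η) :
    ∃ φ : SimpleFunc X X, ∀ x, dist (φ x) x < η := by
  set e := TopologicalSpace.denseSeq X
  have hcov : (Set.univ : Set X) ⊆ ⋃ n, Metric.ball (e n) η := by
    intro x _
    obtain ⟨n, hn⟩ := (TopologicalSpace.denseRange_denseSeq X).exists_dist_lt x hη
    exact Set.mem_iUnion.mpr ⟨n, hn⟩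
  obtain ⟨F, hF⟩ := isCompact_univ.elim_finite_subcover _ (fun n => Metric.isOpen_ball) hcov
  refine ⟨SimpleFunc.nearestPt e (F.sup id), fun x => ?_⟩
  obtain ⟨n, hn, hx⟩ := Set.mem_iUnion₂.mp (hF (Set.mem_univ x))
  have h := SimpleFunc.edist_nearestPt_le e x (Finset.le_sup (f := id) hn)
  rw [Metric.mem_ball', ← edist_lt_ofReal] at hx
  exact edist_lt_ofReal.mp (h.trans_lt hx)

/-- The density argument behind every lower bound. Let `Q` be a property of sets and suppose that
near every point there is a probability measure `ν` such that `Q B` holds as soon as `ν` gives a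
fixed thickening of `B` mass more than `δ`. Then the measures `μ` such that `Q B` holds as soon as
`2 * δ < μ B` contain a dense open set: a given measure is approximated by a mixture of finitely
many of the local measures, and if the mixture gives a set mass more than `δ`, then so does one of
its components. The scales of the components need not be comparable. -/
theorem dense_interior_of_local_witness [CompactSpace X] {δ : ℝ≥0∞} (hδ : 0 < δ) (hδ' : δ ≠ ⊤)
    (Q : Set X → Prop)
    (h : ∀ x : X, ∀ η : ℝ, 0 < η → ∃ ν : ProbabilityMeasure X,
      (ν : Measure X) (Metric.ball x η) = 1 ∧
      ∃ ρ : ℝ, 0 < ρ ∧ ∀ B, δ < (ν : Measure X) (Metric.thickening ρ B) → Q B) :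
    Dense (interior {μ : ProbabilityMeasure X |
      ∀ B, MeasurableSet B → 2 * δ < (μ : Measure X) B → Q B}) := by
  intro μ
  refine mem_closure_of_forall_measure_le_thickening fun ε hε => ?_
  have : Nonempty X := μ.nonempty
  choose ν hν ρ hρ hQ using fun x => h x (ε / 2) (by positivity)
  obtain ⟨φ, hφ⟩ := exists_simpleFunc_dist_lt (X := X) (η := ε / 2) (by positivity)
  set m : Measure X := ∑ y ∈ φ.range, (μ : Measure X) (φ ⁻¹' {y}) • (ν y : Measure X) with hm
  have hsum : ∑ y ∈ φ.range, (μ : Measure X) (φ ⁻¹' {y}) = 1 := by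
    rw [SimpleFunc.sum_range_measure_preimage_singleton]
    exact measure_univ
  have happ : ∀ B, m B = ∑ y ∈ φ.range, (μ : Measure X) (φ ⁻¹' {y}) * (ν y : Measure X) B := by
    intro B
    simp [hm, Measure.finsetSum_apply]
  have hprob : IsProbabilityMeasure m := ⟨by rw [happ]; simpa using hsum⟩
  refine ⟨(⟨m, hprob⟩ : ProbabilityMeasure X), ?_, ?_⟩
  · refine mem_interior_iff_mem_nhds.mpr ?_
    have hev : ∀ᶠ r : ℝ in 𝓝[>] 0, ∀ y ∈ φ.range, r < ρ y := by
      rw [eventually_all_finset]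
      exact fun y _ => nhdsWithin_le_nhds (Iio_mem_nhds (hρ y))
    obtain ⟨r, ⟨hr0, hrδ⟩, hrρ⟩ := ((eventually_pos_and_ofReal_lt hδ).and hev).exists
    filter_upwards [eventually_measure_le_thickening ⟨m, hprob⟩ hr0] with μ' hμ' B hB hlt
    have h1 : 2 * δ < m (Metric.thickening r B) + δ :=
      hlt.trans_le ((hμ' B hB).1.trans (add_le_add le_rfl hrδ.le))
    have h2 : δ < m (Metric.thickening r B) := by
      rw [two_mul] at h1
      exact (ENNReal.add_lt_add_iff_right hδ').mp h1
    by_contra hnot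
    refine h2.not_ge ?_
    rw [happ]
    calc ∑ y ∈ φ.range, (μ : Measure X) (φ ⁻¹' {y}) * (ν y : Measure X) (Metric.thickening r B)
        ≤ ∑ y ∈ φ.range, (μ : Measure X) (φ ⁻¹' {y}) * δ := by
          refine Finset.sum_le_sum fun y hy => ?_
          gcongr
          by_contra hy'
          exact hnot (hQ y B ((not_le.mp hy').trans_le
            (measure_mono (Metric.thickening_mono (hrρ y hy).le B))))
      _ = δ := by rw [← Finset.sum_mul, hsum, one_mul]
  · intro B hB
    refine le_add_right ?_
    change (μ : Measure X) B ≤ m _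
    rw [happ, ← Measure.restrict_apply_univ, ← SimpleFunc.sum_range_measure_preimage_singleton φ]
    refine Finset.sum_le_sum fun y _ => ?_
    rw [Measure.restrict_apply (φ.measurableSet_fiber y)]
    rcases (φ ⁻¹' {y} ∩ B).eq_empty_or_nonempty with he | ⟨x, hxy, hxB⟩
    · simp [he]
    · -- the fibre meets `B`, so the ball carrying `ν y` lies in the thickening of `B`
      have hsub : Metric.ball y (ε / 2) ⊆ Metric.thickening ε B := by
        intro z hz
        have h1 := hφ x
        rw [show φ x = y from hxy] at h1
        rw [Metric.mem_thickening_iff]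
        refine ⟨x, hxB, ?_⟩
        have := dist_triangle z y x
        rw [Metric.mem_ball] at hz
        linarith
      calc (μ : Measure X) (φ ⁻¹' {y} ∩ B) ≤ (μ : Measure X) (φ ⁻¹' {y}) * 1 := by
            rw [mul_one]; exact measure_mono Set.inter_subset_left
        _ ≤ _ := by
            gcongr
            rw [← hν y]
            exact measure_mono hsub

theorem dense_interior_measure_pos [TopologicalSpace.SeparableSpace X] {U : Set X} (hU : IsOpen U)
    (hne : U.Nonempty) :
    Dense (interior {μ : ProbabilityMeasure X | 0 < (μ : Measure X) U}) := by
  obtain ⟨x, hx⟩ := hne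
  obtain ⟨R, hR, hball⟩ := Metric.isOpen_iff.mp hU x hx
  intro μ
  refine mem_closure_of_forall_measure_le_thickening fun ε hε => ?_
  set a : ℝ≥0∞ := ENNReal.ofReal (min ε 1) with ha
  have ha0 : 0 < a := ENNReal.ofReal_pos.mpr (by positivity)
  have ha1 : a ≤ 1 := ENNReal.ofReal_le_one.mpr (min_le_right _ _)
  -- a small atom at `x` is added to `μ`
  set m : Measure X := (1 - a) • (μ : Measure X) + a • Measure.dirac x with hm
  have hprob : IsProbabilityMeasure m := ⟨by simp [hm, tsub_add_cancel_of_le ha1]⟩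
  refine ⟨(⟨m, hprob⟩ : ProbabilityMeasure X), ?_, ?_⟩
  · refine mem_interior_iff_mem_nhds.mpr ?_
    obtain ⟨r, ⟨hr0, hra⟩, hrR⟩ := ((eventually_pos_and_ofReal_lt ha0).and
      (nhdsWithin_le_nhds (Iio_mem_nhds hR))).exists
    filter_upwards [eventually_measure_le_thickening ⟨m, hprob⟩ hr0] with μ' hμ'
    have h1 := (hμ' {x} (measurableSet_singleton x)).2
    rw [Metric.thickening_singleton] at h1
    have h2 : a ≤ m {x} := by simp [hm]
    have h3 : ENNReal.ofReal r < (μ' : Measure X) (Metric.ball x r) + ENNReal.ofReal r :=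
      hra.trans_le (h2.trans h1)
    refine lt_of_lt_of_le (pos_iff_ne_zero.mpr ?_)
      (measure_mono ((Metric.ball_subset_ball hrR.le).trans hball))
    intro h0
    simp [h0] at h3
  · intro B _
    have h1 : (μ : Measure X) B ≤ m B + a := by
      calc (μ : Measure X) B = (1 - a + a) * (μ : Measure X) B := by
            rw [tsub_add_cancel_of_le ha1, one_mul]
        _ = (1 - a) * (μ : Measure X) B + a * (μ : Measure X) B := add_mul _ _ _
        _ ≤ m B + a := by
            gcongr
            · simp [hm]
            · exact mul_le_of_le_one_right' prob_le_one
    refine h1.trans (add_le_add (measure_mono (Metric.self_subset_thickening hε B)) ?_)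
    exact ENNReal.ofReal_le_ofReal (min_le_left _ _)

theorem residual_of_dense_interior {Y : Type*} [TopologicalSpace Y] {S : Set Y}
    (h : Dense (interior S)) : S ∈ residual Y :=
  mem_of_superset (residual_of_dense_open isOpen_interior h) interior_subset

theorem eventually_residual_measure_pos [TopologicalSpace.SeparableSpace X] :
    ∀ᶠ μ : ProbabilityMeasure X in residual _,
      ∀ U : Set X, IsOpen U → U.Nonempty → 0 < (μ : Measure X) U := by
  have : SecondCountableTopology X := UniformSpace.secondCountable_of_separable X
  have h : ∀ᶠ μ : ProbabilityMeasure X in residual _,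
      ∀ U ∈ TopologicalSpace.countableBasis X, 0 < (μ : Measure X) U := by
    rw [eventually_countable_ball (TopologicalSpace.countable_countableBasis X)]
    exact fun U hU => residual_of_dense_interior (dense_interior_measure_pos
      (TopologicalSpace.isOpen_of_mem_countableBasis hU)
      (TopologicalSpace.nonempty_of_mem_countableBasis hU))
  filter_upwards [h] with μ hμ U hU ⟨x, hx⟩
  obtain ⟨V, hV, -, hVU⟩ :=
    (TopologicalSpace.isBasis_countableBasis X).exists_subset_of_mem_open hx hU
  exact (hμ V hV).trans_le (measure_mono hVU)

theorem mem_of_lt_dirac {Y : Type*} [MeasurableSpace Y] {x : Y} {S : Set Y}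
    (hS : MeasurableSet S) {δ : ℝ≥0∞} (h : δ < Measure.dirac x S) : x ∈ S := by
  by_contra hn
  simp [hS, hn] at h

theorem tendsto_two_mul_inv_natCast_add_one :
    Tendsto (fun n : ℕ => 2 * ((n : ℝ≥0∞) + 1)⁻¹) atTop (𝓝 0) := by
  have h := (tendsto_add_atTop_iff_nat 1).mpr ENNReal.tendsto_inv_nat_nhds_zero
  have h2 := ENNReal.Tendsto.const_mul (a := 2) h (Or.inr (by simp))
  simpa using h2

theorem eventually_residual_measure_compl_eq_zero [CompactSpace X] {O : Set X} (hO : IsOpen O)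
    (hd : Dense O) :
    ∀ᶠ μ : ProbabilityMeasure X in residual _, (μ : Measure X) Oᶜ = 0 := by
  have h : ∀ᶠ μ : ProbabilityMeasure X in residual _, ∀ n : ℕ, ∀ B, MeasurableSet B →
      2 * ((n : ℝ≥0∞) + 1)⁻¹ < (μ : Measure X) B → (B ∩ O).Nonempty := by
    rw [eventually_countable_forall]
    intro n
    refine residual_of_dense_interior (dense_interior_of_local_witness (by simp) (by simp) _ ?_)
    intro x η hη
    obtain ⟨y, hyO, hyη⟩ := hd.exists_mem_open Metric.isOpen_ball ⟨x, Metric.mem_ball_self hη⟩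
    obtain ⟨ρ, hρ, hsub⟩ := Metric.isOpen_iff.mp hO y hyO
    refine ⟨(⟨Measure.dirac y, inferInstance⟩ : ProbabilityMeasure X), ?_, ρ, hρ, fun B hB => ?_⟩
    · exact Measure.dirac_apply_of_mem hyη
    · have hmem : y ∈ Metric.thickening ρ B :=
        mem_of_lt_dirac Metric.isOpen_thickening.measurableSet hB
      obtain ⟨z, hz, hd⟩ := Metric.mem_thickening_iff.mp hmem
      exact ⟨z, hz, hsub (Metric.mem_ball'.mpr hd)⟩
  filter_upwards [h] with μ hμ
  by_contra hne
  obtain ⟨n, hn⟩ :=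
    ((tendsto_order.mp tendsto_two_mul_inv_natCast_add_one).2 _ (pos_iff_ne_zero.mpr hne)).exists
  obtain ⟨z, hz, hz'⟩ := hμ n Oᶜ hO.measurableSet.compl hn
  exact hz hz'

end WeakTopology

/-! ### Covering sums and upper dimensions -/

section Dimension

variable {d : ℕ} {π : Measure (EuclideanSpace ℝ (Fin d))}

theorem coveringSum_mono (q r : ℝ) {E F : Set (EuclideanSpace ℝ (Fin d))} (h : E ⊆ F) :
    coveringSum π q E r ≤ coveringSum π q F r :=
  iInf_mono fun _ => iInf_mono fun _ => le_iInf fun hF => iInf_le_of_le (h.trans hF) le_rfl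

/-- The union of two covers, as a set of centres, covers the union. -/
theorem coveringSum_union_le (q r : ℝ) (E F : Set (EuclideanSpace ℝ (Fin d))) :
    coveringSum π q (E ∪ F) r ≤ coveringSum π q E r + coveringSum π q F r := by
  simp only [coveringSum, ENNReal.iInf_add, ENNReal.add_iInf]
  refine le_iInf fun t => le_iInf fun ht => le_iInf fun hF => le_iInf fun s => le_iInf fun hs =>
    le_iInf fun hE => ?_
  refine iInf_le_of_le (s ∪ t) (iInf_le_of_le (Set.union_subset hs ht) (iInf_le_of_le ?_ ?_))
  · rw [Set.biUnion_union]
    exact Set.union_subset_union hE hF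
  · exact ENNReal.tsum_union_le (fun x => π (Metric.ball x r) ^ q) s t

theorem neg_log_pos {r : ℝ} (h0 : 0 < r) (h1 : r < 1) : (0 : EReal) < ((-Real.log r : ℝ) : EReal) :=
  EReal.coe_pos.mpr (neg_pos.mpr (Real.log_neg h0 h1))

theorem log_ofReal_rpow_neg {r : ℝ} (h0 : 0 < r) (t : ℝ) :
    ENNReal.log (ENNReal.ofReal (r ^ (-t))) = (t : EReal) * ((-Real.log r : ℝ) : EReal) := by
  rw [ENNReal.log_ofReal_of_pos (Real.rpow_pos_of_pos h0 _), Real.log_rpow h0, ← EReal.coe_mul]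
  congr 1
  ring

theorem lt_log_div_iff {r t : ℝ} (h0 : 0 < r) (h1 : r < 1) (N : ℝ≥0∞) :
    (t : EReal) < ENNReal.log N / ((-Real.log r : ℝ) : EReal) ↔ ENNReal.ofReal (r ^ (-t)) < N := by
  rw [EReal.lt_div_iff (neg_log_pos h0 h1) (EReal.coe_ne_top _), ← log_ofReal_rpow_neg h0,
    ENNReal.log_lt_log_iff]

theorem log_div_lt_iff {r t : ℝ} (h0 : 0 < r) (h1 : r < 1) (N : ℝ≥0∞) :
    ENNReal.log N / ((-Real.log r : ℝ) : EReal) < (t : EReal) ↔ N < ENNReal.ofReal (r ^ (-t)) := by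
  rw [EReal.div_lt_iff (neg_log_pos h0 h1) (EReal.coe_ne_top _), ← log_ofReal_rpow_neg h0,
    ENNReal.log_lt_log_iff]

theorem eventually_mem_Ioo_nhdsGT {a : ℝ} (ha : 0 < a) : ∀ᶠ r : ℝ in 𝓝[>] 0, 0 < r ∧ r < a :=
  Ioo_mem_nhdsGT ha

/-- Covering sums are compared with powers of the radius only through this lemma and the next
three, which avoids arithmetic with the values `±∞` of the upper dimension. -/
theorem eventually_coveringSum_lt {q t : ℝ} {E : Set (EuclideanSpace ℝ (Fin d))}
    (h : upperDim π q E < t) :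
    ∀ᶠ r : ℝ in 𝓝[>] 0, coveringSum π q E r < ENNReal.ofReal (r ^ (-t)) := by
  filter_upwards [eventually_lt_of_limsup_lt h, eventually_mem_Ioo_nhdsGT one_pos] with r hr h01
  exact (log_div_lt_iff h01.1 h01.2 _).mp hr

theorem upperDim_le_of_eventually {q t : ℝ} {E : Set (EuclideanSpace ℝ (Fin d))}
    (h : ∀ᶠ r : ℝ in 𝓝[>] 0, coveringSum π q E r ≤ ENNReal.ofReal (r ^ (-t))) :
    upperDim π q E ≤ t := by
  refine limsup_le_of_le (by isBoundedDefault) ?_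
  filter_upwards [h, eventually_mem_Ioo_nhdsGT one_pos] with r hr h01
  exact not_lt.mp fun hlt => hr.not_gt ((lt_log_div_iff h01.1 h01.2 _).mp hlt)

theorem frequently_lt_coveringSum {q t : ℝ} {E : Set (EuclideanSpace ℝ (Fin d))}
    (h : t < upperDim π q E) :
    ∃ᶠ r : ℝ in 𝓝[>] 0, ENNReal.ofReal (r ^ (-t)) < coveringSum π q E r := by
  refine ((frequently_lt_of_lt_limsup (by isBoundedDefault) h).and_eventually
    (eventually_mem_Ioo_nhdsGT one_pos)).mono fun r ⟨hr, h01⟩ => ?_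
  exact (lt_log_div_iff h01.1 h01.2 _).mp hr

theorem le_upperDim_of_frequently {q t : ℝ} {E : Set (EuclideanSpace ℝ (Fin d))}
    (h : ∃ᶠ r : ℝ in 𝓝[>] 0, ENNReal.ofReal (r ^ (-t)) ≤ coveringSum π q E r) :
    t ≤ upperDim π q E := by
  refine le_limsup_of_frequently_le ?_ (by isBoundedDefault)
  refine (h.and_eventually (eventually_mem_Ioo_nhdsGT one_pos)).mono fun r ⟨hr, h01⟩ => ?_
  exact not_lt.mp fun hlt => hr.not_gt ((log_div_lt_iff h01.1 h01.2 _).mp hlt)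

/-- Constant factors are absorbed by an arbitrarily small loss in the exponent. -/
theorem eventually_mul_rpow_le {t t' : ℝ} (h : t < t') {c : ℝ≥0∞} (hc : c ≠ ⊤) :
    ∀ᶠ r : ℝ in 𝓝[>] 0, c * ENNReal.ofReal (r ^ (-t)) ≤ ENNReal.ofReal (r ^ (-t')) := by
  have hlim : Tendsto (fun r : ℝ => r ^ (-(t' - t))) (𝓝[>] 0) atTop :=
    tendsto_rpow_neg_nhdsGT_zero (by linarith)
  filter_upwards [hlim.eventually_ge_atTop c.toReal, self_mem_nhdsWithin] with r hr h0
  rw [← ENNReal.ofReal_toReal hc, ← ENNReal.ofReal_mul ENNReal.toReal_nonneg]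
  refine ENNReal.ofReal_le_ofReal ?_
  have hsplit : r ^ (-t') = r ^ (-(t' - t)) * r ^ (-t) := by
    rw [← Real.rpow_add h0]; congr 1; ring
  rw [hsplit]
  exact mul_le_mul_of_nonneg_right hr (Real.rpow_nonneg (le_of_lt h0) _)

theorem upperDim_mono (q : ℝ) {E F : Set (EuclideanSpace ℝ (Fin d))} (h : E ⊆ F) :
    upperDim π q E ≤ upperDim π q F := by
  refine EReal.le_of_forall_lt_iff_le.mp fun t ht => upperDim_le_of_eventually ?_
  filter_upwards [eventually_coveringSum_lt ht] with r hr
  exact (coveringSum_mono q r h).trans hr.le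

theorem exists_real_between {x : EReal} {s : ℝ} (h : x < s) : ∃ t : ℝ, x < t ∧ t < s := by
  obtain ⟨t, h1, h2⟩ := EReal.lt_iff_exists_real_btwn.mp h
  exact ⟨t, h1, EReal.coe_lt_coe_iff.mp h2⟩

theorem upperDim_union_le (q : ℝ) (E F : Set (EuclideanSpace ℝ (Fin d))) :
    upperDim π q (E ∪ F) ≤ max (upperDim π q E) (upperDim π q F) := by
  refine EReal.le_of_forall_lt_iff_le.mp fun s hs => upperDim_le_of_eventually ?_
  obtain ⟨t, ht, hts⟩ := exists_real_between hs
  filter_upwards [eventually_coveringSum_lt ((le_max_left _ _).trans_lt ht),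
    eventually_coveringSum_lt ((le_max_right _ _).trans_lt ht),
    eventually_mul_rpow_le hts (c := 2) (by simp)] with r h1 h2 h3
  refine (coveringSum_union_le q r E F).trans ((add_le_add h1.le h2.le).trans ?_)
  rwa [← two_mul]

theorem upperDim_empty (q : ℝ) : upperDim π q ∅ = ⊥ := by
  refine le_bot_iff.mp (EReal.le_of_forall_lt_iff_le.mp fun t _ => upperDim_le_of_eventually ?_)
  refine Eventually.of_forall fun r => ?_
  refine iInf_le_of_le ∅ (iInf_le_of_le (Set.empty_subset _) (iInf_le_of_le (by simp) ?_))
  simp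

theorem upperDim_biUnion_lt {ι : Type*} (q : ℝ) (F : Finset ι)
    (W : ι → Set (EuclideanSpace ℝ (Fin d))) {t : ℝ} (h : ∀ i ∈ F, upperDim π q (W i) < t) :
    upperDim π q (⋃ i ∈ F, W i) < t := by
  classical
  induction F using Finset.induction_on with
  | empty => simp [upperDim_empty]
  | insert a s _ ih =>
    rw [Finset.set_biUnion_insert]
    refine (upperDim_union_le q _ _).trans_lt (max_lt (h a (Finset.mem_insert_self a s)) ?_)
    exact ih fun i hi => h i (Finset.mem_insert_of_mem hi)

end Dimension

/-! ### Consequences of doubling -/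

section Doubling

variable {d : ℕ} {π : Measure (EuclideanSpace ℝ (Fin d))}

/-- Comparability in both directions is what makes the estimate valid for exponents of either
sign. -/
theorem ennreal_rpow_le_of_comparable {a b M : ℝ≥0∞} (ha : a ≠ ⊤) (hM : M ≠ 0)
    (hM' : M ≠ ⊤) (hab : a ≤ M * b) (hba : b ≤ M * a) (q : ℝ) : a ^ q ≤ M ^ |q| * b ^ q := by
  rcases le_total 0 q with hq | hq
  · rw [abs_of_nonneg hq, ← ENNReal.mul_rpow_of_nonneg _ _ hq]
    exact ENNReal.rpow_le_rpow hab hq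
  · have h1 : (M * a) ^ q ≤ b ^ q := by
      rw [← neg_neg q, ENNReal.rpow_neg, ENNReal.rpow_neg b]
      exact ENNReal.inv_le_inv.mpr (ENNReal.rpow_le_rpow hba (by linarith))
    rw [ENNReal.mul_rpow_of_ne_top hM' ha] at h1
    calc a ^ q = M ^ |q| * (M ^ q * a ^ q) := by
          rw [← mul_assoc, abs_of_nonpos hq, ← ENNReal.rpow_add _ _ hM hM']; simp
      _ ≤ _ := by gcongr

theorem measure_ball_pos {x : EuclideanSpace ℝ (Fin d)} (hx : x ∈ π.support) {r : ℝ} (hr : 0 < r) :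
    0 < π (Metric.ball x r) :=
  (Measure.mem_support_iff_forall x).mp hx _ (Metric.ball_mem_nhds x hr)

theorem IsDoubling.exists_one_le (hd : IsDoubling π) :
    ∃ C : ℝ≥0, 1 ≤ C ∧ ∀ x ∈ π.support, ∀ r : ℝ, 0 < r →
      π (Metric.ball x (2 * r)) ≤ C * π (Metric.ball x r) := by
  obtain ⟨C, hC⟩ := hd
  refine ⟨max C 1, le_max_right _ _, fun x hx r hr => (hC x hx r hr).trans ?_⟩
  gcongr
  exact le_max_left _ _

theorem measure_ball_two_pow_mul_le {C : ℝ≥0}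
    (hC : ∀ x ∈ π.support, ∀ r : ℝ, 0 < r →
      π (Metric.ball x (2 * r)) ≤ C * π (Metric.ball x r))
    {x : EuclideanSpace ℝ (Fin d)} (hx : x ∈ π.support) {r : ℝ} (hr : 0 < r) (n : ℕ) :
    π (Metric.ball x (2 ^ n * r)) ≤ C ^ n * π (Metric.ball x r) := by
  induction n with
  | zero => simp
  | succ n ih =>
    rw [pow_succ', mul_assoc, pow_succ', mul_assoc]
    exact (hC x hx _ (by positivity)).trans (by gcongr)

/-- The weights `π(B(x, a)) ^ q` and `π(B(y, r)) ^ q` are comparable when the centres are close and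
the radii differ by at most a factor `8`. -/
theorem IsDoubling.exists_measure_ball_rpow_le [IsFiniteMeasure π] (hd : IsDoubling π) (q : ℝ) :
    ∃ M : ℝ≥0∞, M ≠ 0 ∧ M ≠ ⊤ ∧ ∀ x ∈ π.support, ∀ y ∈ π.support, ∀ r a : ℝ, 0 < r → r ≤ a →
      a ≤ 8 * r → dist x y < 2 * r → π (Metric.ball x a) ^ q ≤ M * π (Metric.ball y r) ^ q := by
  obtain ⟨C, hC1, hC⟩ := hd.exists_one_le
  have hC0 : (C : ℝ≥0∞) ^ 4 ≠ 0 := pow_ne_zero _ (by simpa using (one_pos.trans_le hC1).ne')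
  refine ⟨((C : ℝ≥0∞) ^ 4) ^ |q|, ?_, by finiteness, ?_⟩
  · exact (ENNReal.rpow_pos (pos_iff_ne_zero.mpr hC0) (by finiteness)).ne'
  intro x hx y hy r a hr hra ha hxy
  refine ennreal_rpow_le_of_comparable (measure_ne_top _ _) hC0
    (by finiteness) ?_ ?_ q
  · refine (measure_mono (Metric.ball_subset_ball' ?_)).trans
      (measure_ball_two_pow_mul_le hC hy hr 4)
    linarith
  · calc π (Metric.ball y r) ≤ π (Metric.ball x (2 ^ 4 * r)) := by
          refine measure_mono (Metric.ball_subset_ball' ?_)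
          rw [dist_comm]; linarith
      _ ≤ C ^ 4 * π (Metric.ball x r) := measure_ball_two_pow_mul_le hC hx hr 4
      _ ≤ _ := by gcongr

/-- A doubling measure with compact support satisfies `π(B(x, r)) ≥ A⁻¹ r ^ s` uniformly for `x` in
its support and `0 < r < 1`. -/
theorem IsDoubling.exists_one_le_mul_measure_ball [IsProbabilityMeasure π] (hd : IsDoubling π)
    (hc : IsCompact π.support) :
    ∃ A s : ℝ, 0 < A ∧ ∀ x ∈ π.support, ∀ r : ℝ, 0 < r → r < 1 →
      1 ≤ ENNReal.ofReal (A * r ^ (-s)) * π (Metric.ball x r) := by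
  obtain ⟨C, hC1, hC⟩ := hd.exists_one_le
  obtain ⟨D, hD1, hD⟩ : ∃ D : ℝ, 1 ≤ D ∧ ∀ x ∈ π.support, π (Metric.ball x D) = 1 := by
    refine ⟨Metric.diam π.support + 1, by linarith [Metric.diam_nonneg (s := π.support)], ?_⟩
    intro x hx
    refine le_antisymm prob_le_one ?_
    have hfull : π π.support = 1 :=
      (prob_compl_eq_zero_iff Measure.isClosed_support.measurableSet).mp
        Measure.measure_compl_support
    rw [← hfull]
    refine measure_mono fun y hy => Metric.mem_ball.mpr ?_
    linarith [Metric.dist_le_diam_of_mem hc.isBounded hy hx]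
  have hCpos : (0 : ℝ) < C := by exact_mod_cast one_pos.trans_le hC1
  -- the exponent for which `C = 2 ^ s`
  set s := Real.logb 2 C with hs
  have hs0 : 0 ≤ s := Real.logb_nonneg (by norm_num) (by exact_mod_cast hC1)
  refine ⟨(2 * D) ^ s, s, by positivity, fun x hx r hr hr1 => ?_⟩
  have hDr : 1 ≤ D / r := by rw [le_div_iff₀ hr]; linarith
  obtain ⟨n, hn1, hn2⟩ := exists_nat_pow_near hDr one_lt_two
  -- `2 ^ n ≤ D / r < 2 ^ (n + 1)`
  have h1 : (1 : ℝ≥0∞) ≤ C ^ (n + 1) * π (Metric.ball x r) := by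
    rw [← hD x hx]
    refine (measure_mono (Metric.ball_subset_ball ?_)).trans
      (measure_ball_two_pow_mul_le hC hx hr (n + 1))
    exact ((div_lt_iff₀ hr).mp hn2).le
  refine h1.trans ?_
  gcongr
  rw [← ENNReal.coe_pow, ← ENNReal.ofReal_coe_nnreal]
  refine ENNReal.ofReal_le_ofReal ?_
  have hCs : (C : ℝ) = 2 ^ s := (Real.rpow_logb (by norm_num) (by norm_num) hCpos).symm
  calc (((C ^ (n + 1) : ℝ≥0)) : ℝ) = ((2 : ℝ) ^ (n + 1)) ^ s := by
        push_cast
        rw [hCs, ← Real.rpow_natCast, ← Real.rpow_mul (by norm_num), mul_comm,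
          Real.rpow_mul (by norm_num), Real.rpow_natCast]
    _ ≤ (2 * D / r) ^ s := by
        refine Real.rpow_le_rpow (by positivity) ?_ hs0
        rw [pow_succ', mul_div_assoc]
        gcongr
    _ = (2 * D) ^ s * r ^ (-s) := by
        rw [Real.div_rpow (by positivity) hr.le, Real.rpow_neg hr.le, div_eq_mul_inv]

/-- The upper dimension is Lipschitz in the order `q`, with a constant that does not depend on the
set. -/
theorem IsDoubling.exists_upperDim_le_add [IsProbabilityMeasure π] (hd : IsDoubling π)
    (hc : IsCompact π.support) :
    ∃ s : ℝ, ∀ (q q' : ℝ) (E : Set (EuclideanSpace ℝ (Fin d))),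
      upperDim π q' E ≤ upperDim π q E + ((s * |q' - q| : ℝ) : EReal) := by
  obtain ⟨A, s, hA, h⟩ := hd.exists_one_le_mul_measure_ball hc
  refine ⟨s, fun q q' E => ?_⟩
  set u := s * |q' - q| with hu
  rw [← EReal.sub_le_iff_le_add (Or.inl (EReal.coe_ne_bot _)) (Or.inl (EReal.coe_ne_top _))]
  refine EReal.le_of_forall_lt_iff_le.mp fun t ht => ?_
  rw [EReal.sub_le_iff_le_add (Or.inl (EReal.coe_ne_bot _)) (Or.inl (EReal.coe_ne_top _)),
    ← EReal.coe_add]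
  obtain ⟨t', ht', htt'⟩ := exists_real_between ht
  refine upperDim_le_of_eventually ?_
  have hlt : t' + u < t + u := by linarith
  filter_upwards [eventually_coveringSum_lt ht', eventually_mem_Ioo_nhdsGT one_pos,
    eventually_mul_rpow_le hlt (c := ENNReal.ofReal (A ^ |q' - q|)) (by simp)] with r h1 h01 h2
  obtain ⟨hr0, hr1⟩ := h01
  set M : ℝ≥0∞ := ENNReal.ofReal (A * r ^ (-s)) with hM
  have hMpos : M ≠ 0 := (ENNReal.ofReal_pos.mpr (by positivity)).ne'
  have hterm : ∀ x ∈ π.support,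
      π (Metric.ball x r) ^ q' ≤ M ^ |q' - q| * π (Metric.ball x r) ^ q := by
    intro x hx
    have hx1 := h x hx r hr0 hr1
    have hp := measure_ball_pos hx hr0
    have hM1 : 1 ≤ M := hx1.trans (mul_le_of_le_one_right' prob_le_one)
    have hle := ennreal_rpow_le_of_comparable (b := 1) (measure_ne_top π (Metric.ball x r))
      hMpos ENNReal.ofReal_ne_top (by rw [mul_one]; exact prob_le_one.trans hM1) hx1 (q' - q)
    rw [ENNReal.one_rpow, mul_one] at hle
    calc π (Metric.ball x r) ^ q' = π (Metric.ball x r) ^ (q' - q) * π (Metric.ball x r) ^ q := by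
          rw [← ENNReal.rpow_add _ _ hp.ne' (measure_ne_top _ _)]; simp
      _ ≤ _ := by gcongr
  have hcov : coveringSum π q' E r ≤ M ^ |q' - q| * coveringSum π q E r := by
    have hfin : M ^ |q' - q| ≠ ⊤ := by finiteness
    have hne : M ^ |q' - q| ≠ 0 :=
      (ENNReal.rpow_pos (pos_iff_ne_zero.mpr hMpos) ENNReal.ofReal_ne_top).ne'
    simp only [coveringSum, ENNReal.mul_iInf_of_ne hne hfin]
    refine iInf_mono fun S => iInf_mono fun hS => iInf_mono fun _ => ?_
    rw [← ENNReal.tsum_mul_left]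
    exact ENNReal.tsum_le_tsum fun x => hterm x (hS x.2)
  refine hcov.trans ((mul_le_mul_right h1.le _).trans (le_trans (le_of_eq ?_) h2))
  rw [hM, ENNReal.ofReal_rpow_of_pos (by positivity), ← ENNReal.ofReal_mul (by positivity),
    ← ENNReal.ofReal_mul (by positivity)]
  congr 1
  rw [Real.mul_rpow hA.le (by positivity), ← Real.rpow_mul hr0.le, mul_assoc,
    ← Real.rpow_add hr0]
  congr 2
  rw [hu]; ring

end Doubling

/-! ### Finitely supported measures spread evenly at one scale -/

section LocalWitness

variable {d : ℕ} {π : Measure (EuclideanSpace ℝ (Fin d))}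

theorem exists_finset_separated_cover (hc : IsCompact π.support) (V : Set π.support) {ε : ℝ}
    (hε : 0 < ε) :
    ∃ F : Finset π.support, ↑F ⊆ V ∧ (∀ y ∈ F, ∀ z ∈ F, y ≠ z → ε < dist y z) ∧
      ∀ x ∈ V, ∃ y ∈ F, dist x y ≤ ε := by
  have : CompactSpace π.support := isCompact_iff_compactSpace.mp hc
  -- packing at scale `2 * e` is controlled by covering at scale `e`
  set e : ℝ≥0 := ⟨ε / 2, by positivity⟩ with he
  have he0 : e ≠ 0 := fun h => (half_pos hε).ne' (congrArg NNReal.toReal h)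
  have h2e : (((2 * e : ℝ≥0) : ℝ)) = ε := by
    rw [NNReal.coe_mul]; exact mul_div_cancel₀ ε two_ne_zero
  have hfin : Metric.packingNumber (2 * e) V ≠ ⊤ := by
    obtain ⟨N, -, hN, hcov⟩ := Metric.exists_finite_isCover_of_totallyBounded he0
      (isCompact_univ.totallyBounded.subset (Set.subset_univ V))
    refine ne_top_of_le_ne_top (hN.encard_lt_top.ne) ?_
    exact (Metric.packingNumber_two_mul_le_externalCoveringNumber e V).trans
      hcov.externalCoveringNumber_le_encard
  have hF : (Metric.maximalSeparatedSet (2 * e) V).Finite := by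
    rw [← Set.encard_lt_top_iff, Metric.encard_maximalSeparatedSet hfin]
    exact lt_top_iff_ne_top.mpr hfin
  have hcoe : ((2 * e : ℝ≥0) : ℝ≥0∞) = ENNReal.ofReal ε := by
    rw [← ENNReal.ofReal_coe_nnreal, h2e]
  refine ⟨hF.toFinset, by simpa using Metric.maximalSeparatedSet_subset, ?_, ?_⟩
  · intro y hy z hz hyz
    have h := Metric.isSeparated_maximalSeparatedSet (hF.mem_toFinset.mp hy)
      (hF.mem_toFinset.mp hz) hyz
    rw [hcoe, edist_dist] at h
    exact (ENNReal.ofReal_lt_ofReal_iff_of_nonneg hε.le).mp h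
  · intro x hx
    obtain ⟨y, hy, hxy⟩ := Metric.isCover_maximalSeparatedSet hfin hx
    refine ⟨y, hF.mem_toFinset.mpr hy, ?_⟩
    have h : edist x y ≤ ((2 * e : ℝ≥0) : ℝ≥0∞) := hxy
    rw [hcoe, edist_dist] at h
    exact (ENNReal.ofReal_le_ofReal_iff hε.le).mp h

/-- The centres in `F` are so far apart that each ball of a cover of `B` accounts for at most one of
them. -/
theorem sum_separated_le_coveringSum {q r : ℝ} {M : ℝ≥0∞} (hM0 : M ≠ 0) (hM' : M ≠ ⊤)
    (hM : ∀ x ∈ π.support, ∀ y ∈ π.support, dist x y < 2 * r →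
      π (Metric.ball x r) ^ q ≤ M * π (Metric.ball y r) ^ q)
    {F : Finset π.support} {B : Set π.support}
    (hsep : ∀ y ∈ F, ∀ z ∈ F, y ≠ z → 4 * r < dist y z)
    (hF : ∀ y ∈ F, y ∈ Metric.thickening r B) :
    ∑ y ∈ F, π (Metric.ball (y : EuclideanSpace ℝ (Fin d)) r) ^ q ≤
      M * coveringSum π q (Subtype.val '' B) r := by
  simp only [coveringSum, ENNReal.mul_iInf_of_ne hM0 hM']
  refine le_iInf fun s => le_iInf fun hs => le_iInf fun hcov => ?_
  have hex : ∀ y : F, ∃ x : s, dist ((y : π.support) : EuclideanSpace ℝ (Fin d)) x < 2 * r := by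
    intro y
    obtain ⟨b, hb, hyb⟩ := Metric.mem_thickening_iff.mp (hF y y.2)
    obtain ⟨x, hx, hbx⟩ := Set.mem_iUnion₂.mp (hcov ⟨b, hb, rfl⟩)
    refine ⟨⟨x, hx⟩, ?_⟩
    have h1 := dist_triangle ((y : π.support) : EuclideanSpace ℝ (Fin d)) b x
    rw [Metric.mem_ball] at hbx
    rw [Subtype.dist_eq] at hyb
    change dist _ x < _
    linarith
  choose j hj using hex
  have hinj : Function.Injective j := by
    intro y z hyz
    by_contra hne
    have h1 := hsep y y.2 z z.2 (fun h => hne (Subtype.ext h))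
    have h2 := hj y
    have h3 := hj z
    rw [hyz] at h2
    have h4 := dist_triangle_right ((y : π.support) : EuclideanSpace ℝ (Fin d))
      ((z : π.support) : EuclideanSpace ℝ (Fin d)) (j z)
    rw [Subtype.dist_eq] at h1
    linarith
  rw [← Finset.sum_coe_sort]
  calc ∑ y : F, π (Metric.ball ((y : π.support) : EuclideanSpace ℝ (Fin d)) r) ^ q
      ≤ ∑ y : F, M * π (Metric.ball (j y : EuclideanSpace ℝ (Fin d)) r) ^ q :=
        Finset.sum_le_sum fun y _ => hM _ (y : π.support).2 _ (hs (j y).2) (hj y)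
    _ = M * ∑' y : F, π (Metric.ball (j y : EuclideanSpace ℝ (Fin d)) r) ^ q := by
        rw [tsum_fintype, Finset.mul_sum]
    _ ≤ _ := by
        gcongr
        exact ENNReal.tsum_comp_le_tsum_of_injective hinj
          (fun x : s => π (Metric.ball (x : EuclideanSpace ℝ (Fin d)) r) ^ q)

theorem coveringSum_le_sum_finset {q r : ℝ} (F : Finset π.support) {V : Set π.support}
    (hF : ∀ x ∈ V, ∃ y ∈ F, dist x y < r) :
    coveringSum π q (Subtype.val '' V) r ≤
      ∑ y ∈ F, π (Metric.ball (y : EuclideanSpace ℝ (Fin d)) r) ^ q := by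
  set G := F.map (Function.Embedding.subtype (· ∈ π.support)) with hG
  refine iInf_le_of_le (G : Set (EuclideanSpace ℝ (Fin d))) (iInf_le_of_le ?_
    (iInf_le_of_le ?_ (le_of_eq ?_)))
  · intro x hx
    obtain ⟨y, -, rfl⟩ := Finset.mem_map.mp (Finset.mem_coe.mp hx)
    exact y.2
  · rintro _ ⟨x, hx, rfl⟩
    obtain ⟨y, hy, hxy⟩ := hF x hx
    exact Set.mem_iUnion₂.mpr ⟨y, Finset.mem_map_of_mem _ hy, hxy⟩
  · rw [Finset.tsum_subtype' G (fun x => π (Metric.ball x r) ^ q), hG, Finset.sum_map]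
    rfl

/-- If a ball has upper dimension exceeding `t`, then it carries a finitely supported probability
measure such that every set whose thickening has mass more than `δ` has a large covering sum at some
small scale. At a scale `R` where the covering sum of the ball is large, take a maximal separated
set of points and give each point `y` a mass proportional to `π(B(y, r)) ^ q`, where `r = R / 8`. -/
theorem exists_evenly_spread_measure [IsFiniteMeasure π] (hd : IsDoubling π)
    (hc : IsCompact π.support) {q t : ℝ} {x : π.support} {η : ℝ}
    (ht : t < upperDim π q (Subtype.val '' Metric.ball x η)) {δ : ℝ≥0∞} (hδ : 0 < δ)
    (hδ' : δ ≠ ⊤) {r₀ : ℝ} (hr₀ : 0 < r₀) :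
    ∃ ν : ProbabilityMeasure π.support, (ν : Measure π.support) (Metric.ball x η) = 1 ∧
      ∃ ρ : ℝ, 0 < ρ ∧ ∀ B : Set π.support, δ < (ν : Measure π.support) (Metric.thickening ρ B) →
        ∃ r : ℝ, 0 < r ∧ r < r₀ ∧
          ENNReal.ofReal (r ^ (-t)) ≤ coveringSum π q (Subtype.val '' B) r := by
  obtain ⟨t', htt', ht'⟩ := EReal.lt_iff_exists_real_btwn.mp ht
  rw [EReal.coe_lt_coe_iff] at htt'
  obtain ⟨M, hM0, hM', hM⟩ := hd.exists_measure_ball_rpow_le q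
  -- `8 ^ t` accounts for passing from `R` to `R / 8`, and `M` for changing centres and radii
  have hctop : ENNReal.ofReal ((8 : ℝ) ^ t) * (M * M) / δ ≠ ⊤ :=
    ENNReal.div_ne_top (by finiteness) hδ.ne'
  obtain ⟨R, hRN, ⟨hR0, hRr⟩, hRc⟩ := ((frequently_lt_coveringSum ht').and_eventually
    ((eventually_mem_Ioo_nhdsGT hr₀).and (eventually_mul_rpow_le htt' hctop))).exists
  set V : Set π.support := Metric.ball x η
  set r := R / 8 with hr
  have hr0 : 0 < r := by positivity
  have hR8 : R = 8 * r := by rw [hr]; ring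
  -- separation `4 * r`: points within `2 * r` of a common centre coincide; and the balls of radius
  -- `R = 8 * r > 4 * r` around a maximal separated set cover `V`
  obtain ⟨F, hFV, hsep, hcov⟩ := exists_finset_separated_cover hc V (ε := 4 * r) (by positivity)
  set w : π.support → ℝ≥0∞ := fun y => π (Metric.ball (y : EuclideanSpace ℝ (Fin d)) r) ^ q with hw
  set Z := ∑ y ∈ F, w y with hZ
  have hNZ : coveringSum π q (Subtype.val '' V) R ≤ M * Z := by
    refine (coveringSum_le_sum_finset F fun x hx => ?_).trans ?_
    · obtain ⟨y, hy, hxy⟩ := hcov x hx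
      exact ⟨y, hy, hxy.trans_lt (by linarith)⟩
    · rw [hZ, Finset.mul_sum]
      refine Finset.sum_le_sum fun y _ => ?_
      exact hM y y.2 y y.2 r R hr0 (by linarith) hR8.le (by simpa using hr0)
  have hZ0 : Z ≠ 0 := by
    intro h
    rw [h, mul_zero] at hNZ
    exact (hRN.trans_le hNZ).not_ge zero_le
  have hZ' : Z ≠ ⊤ := by
    refine (ENNReal.sum_lt_top.mpr fun y _ => ?_).ne
    exact (ENNReal.rpow_ne_top_of_ne_zero (measure_ball_pos y.2 hr0).ne'
      (measure_ne_top _ _)).lt_top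
  set ν : Measure π.support := Z⁻¹ • ∑ y ∈ F, w y • Measure.dirac y with hν
  have happ : ∀ S : Set π.support, MeasurableSet S →
      ν S = Z⁻¹ * ∑ y ∈ F, w y * S.indicator 1 y := by
    intro S hS
    simp [hν, Measure.finsetSum_apply, Measure.dirac_apply' _ hS]
  have hprob : IsProbabilityMeasure ν :=
    ⟨by rw [happ _ MeasurableSet.univ]; simpa using ENNReal.inv_mul_cancel hZ0 hZ'⟩
  refine ⟨⟨ν, hprob⟩, ?_, r, hr0, fun B hB => ⟨r, hr0, by linarith, ?_⟩⟩
  · change ν V = 1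
    rw [happ _ Metric.isOpen_ball.measurableSet, ← ENNReal.inv_mul_cancel hZ0 hZ', hZ]
    congr 1
    refine Finset.sum_congr rfl fun y hy => ?_
    rw [Set.indicator_of_mem (hFV hy)]
    simp
  · classical
    have hB' : δ < ν (Metric.thickening r B) := hB
    have h1 : Z * ν (Metric.thickening r B) ≤ M * coveringSum π q (Subtype.val '' B) r := by
      rw [happ _ Metric.isOpen_thickening.measurableSet, ← mul_assoc,
        ENNReal.mul_inv_cancel hZ0 hZ', one_mul]
      calc ∑ y ∈ F, w y * (Metric.thickening r B).indicator 1 y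
          = ∑ y ∈ F with y ∈ Metric.thickening r B, w y := by
            rw [Finset.sum_filter]
            refine Finset.sum_congr rfl fun y _ => ?_
            by_cases h : y ∈ Metric.thickening r B <;> simp [h]
        _ ≤ _ := by
            refine sum_separated_le_coveringSum hM0 hM'
              (fun x hx y hy hxy => hM x hx y hy r r hr0 le_rfl (by linarith) hxy) ?_ ?_
            · exact fun y hy z hz =>
                hsep y (Finset.mem_filter.mp hy).1 z (Finset.mem_filter.mp hz).1
            · exact fun y hy => (Finset.mem_filter.mp hy).2
    have h2 : ENNReal.ofReal (r ^ (-t)) = ENNReal.ofReal ((8 : ℝ) ^ t) *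
        ENNReal.ofReal (R ^ (-t)) := by
      rw [← ENNReal.ofReal_mul (by positivity), hr, Real.div_rpow hR0.le (by norm_num),
        Real.rpow_neg (by norm_num : (0 : ℝ) ≤ 8), div_inv_eq_mul, mul_comm]
    -- the constant in `hRc` was chosen for this chain, which passes through `δ * (M * Z)`
    have h3 : (M * M) * ENNReal.ofReal (r ^ (-t)) ≤
        (M * M) * coveringSum π q (Subtype.val '' B) r := by
      calc (M * M) * ENNReal.ofReal (r ^ (-t))
          = δ * (ENNReal.ofReal ((8 : ℝ) ^ t) * (M * M) / δ * ENNReal.ofReal (R ^ (-t))) := by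
            rw [h2, ← mul_assoc δ, ENNReal.mul_div_cancel hδ.ne' hδ']
            ring
        _ ≤ δ * (M * Z) := by
            exact mul_le_mul_right (hRc.trans (hRN.le.trans hNZ)) δ
        _ = M * (Z * δ) := by ring
        _ ≤ M * (M * coveringSum π q (Subtype.val '' B) r) := by
            exact mul_le_mul_right ((mul_le_mul_right hB'.le Z).trans h1) M
        _ = _ := by ring
    exact (ENNReal.mul_le_mul_iff_right (mul_ne_zero hM0 hM0) (by finiteness)).mp h3

end LocalWitness

/-! ### Dimensions of sets charged by a typical measure -/

section Typical

variable {d : ℕ} {π : Measure (EuclideanSpace ℝ (Fin d))}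

/-- The interior, relative to the support `K` of `π`, of the set of points all of whose
neighbourhoods in `K` have upper dimension of order `q` exceeding `t`. -/
def persistentSet (π : Measure (EuclideanSpace ℝ (Fin d))) (q t : ℝ) : Set π.support :=
  interior {x | ∀ r : ℝ, 0 < r → t < upperDim π q (Subtype.val '' Metric.ball x r)}

/-- The set of points of the support `K` of `π` with a ball in `K` around them of upper dimension
of order `q` less than `t`. -/
def thinSet (π : Measure (EuclideanSpace ℝ (Fin d))) (q t : ℝ) : Set π.support :=
  {x | ∃ r : ℝ, 0 < r ∧ upperDim π q (Subtype.val '' Metric.ball x r) < t}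

theorem image_val_ball (x : π.support) (r : ℝ) :
    Subtype.val '' Metric.ball x r = π.support ∩ Metric.ball (x : EuclideanSpace ℝ (Fin d)) r := by
  ext y
  constructor
  · rintro ⟨z, hz, rfl⟩
    exact ⟨z.2, hz⟩
  · rintro ⟨hy, hyr⟩
    exact ⟨⟨y, hy⟩, hyr, rfl⟩

theorem isOpen_thinSet (q t : ℝ) : IsOpen (thinSet π q t) := by
  refine Metric.isOpen_iff.mpr fun x ⟨r, hr, hx⟩ => ⟨r, hr, fun y hy => ?_⟩
  have hy' : dist y x < r := hy
  refine ⟨r - dist y x, by linarith, lt_of_le_of_lt (upperDim_mono q (Set.image_mono ?_)) hx⟩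
  exact Metric.ball_subset_ball' (by linarith)

/-- Near points outside the closure of `persistentSet π q t`, Dirac masses serve as local witnesses;
near points of the closure, the measures of `exists_evenly_spread_measure` do. -/
theorem eventually_residual_le_upperDim [IsFiniteMeasure π] (hd : IsDoubling π)
    (hc : IsCompact π.support) (q t : ℝ) :
    ∀ᶠ μ : ProbabilityMeasure π.support in residual _, ∀ B : Set π.support, MeasurableSet B →
      0 < (μ : Measure π.support) (B ∩ persistentSet π q t) →
      (t : EReal) ≤ upperDim π q (Subtype.val '' B) := by
  have : CompactSpace π.support := isCompact_iff_compactSpace.mp hc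
  set U := persistentSet π q t with hU
  have hUo : IsOpen U := isOpen_interior
  have h : ∀ᶠ μ : ProbabilityMeasure π.support in residual _, ∀ n : ℕ, ∀ B, MeasurableSet B →
      2 * ((n : ℝ≥0∞) + 1)⁻¹ < (μ : Measure π.support) B →
      (B ⊆ U → ∃ r : ℝ, 0 < r ∧ r < ((n : ℝ) + 1)⁻¹ ∧
        ENNReal.ofReal (r ^ (-t)) ≤ coveringSum π q (Subtype.val '' B) r) := by
    rw [eventually_countable_forall]
    intro n
    refine residual_of_dense_interior (dense_interior_of_local_witness (by simp) (by simp) _ ?_)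
    intro x η hη
    by_cases hx : x ∈ closure U
    · obtain ⟨y, hyU, hxy⟩ := Metric.mem_closure_iff.mp hx (η / 2) (by positivity)
      obtain ⟨ν, hν, ρ, hρ, hB⟩ := exists_evenly_spread_measure hd hc
        (interior_subset hyU (η / 2) (by positivity))
        (δ := ((n : ℝ≥0∞) + 1)⁻¹) (by simp) (by simp) (r₀ := ((n : ℝ) + 1)⁻¹) (by positivity)
      refine ⟨ν, le_antisymm prob_le_one ?_, ρ, hρ, fun B h _ => hB B h⟩
      rw [← hν]
      refine measure_mono (Metric.ball_subset_ball' ?_)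
      rw [dist_comm]; linarith
    · obtain ⟨ρ, hρ, hsub⟩ := Metric.isOpen_iff.mp isClosed_closure.isOpen_compl x hx
      refine ⟨(⟨Measure.dirac x, inferInstance⟩ : ProbabilityMeasure π.support),
        Measure.dirac_apply_of_mem (Metric.mem_ball_self hη), ρ, hρ, fun B hB hBU => ?_⟩
      exfalso
      have hmem : x ∈ Metric.thickening ρ B :=
        mem_of_lt_dirac Metric.isOpen_thickening.measurableSet hB
      obtain ⟨z, hz, hxz⟩ := Metric.mem_thickening_iff.mp hmem
      exact hsub (Metric.mem_ball'.mpr hxz) (subset_closure (hBU hz))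
  filter_upwards [h] with μ hμ B hB hpos
  refine le_trans ?_ (upperDim_mono q (Set.image_mono (Set.inter_subset_left (t := U))))
  refine le_upperDim_of_frequently ?_
  rw [frequently_iff]
  intro S hS
  obtain ⟨a, ha, haS⟩ := mem_nhdsGT_iff_exists_Ioo_subset.mp hS
  have h1 := (tendsto_order.mp tendsto_two_mul_inv_natCast_add_one).2 _ hpos
  have h2 : ∀ᶠ n : ℕ in atTop, ((n : ℝ) + 1)⁻¹ < a := by
    have := tendsto_one_div_add_atTop_nhds_zero_nat (𝕜 := ℝ)
    simp only [one_div] at this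
    exact (tendsto_order.mp this).2 _ ha
  obtain ⟨n, hn1, hn2⟩ := (h1.and h2).exists
  obtain ⟨r, hr0, hrn, hr⟩ := hμ n _ (hB.inter hUo.measurableSet) hn1 Set.inter_subset_right
  exact ⟨r, haS ⟨hr0, hrn.trans hn2⟩, hr⟩

theorem exists_rat_between {x y : EReal} (h : x < y) :
    ∃ t : ℚ, x < ((t : ℝ) : EReal) ∧ ((t : ℝ) : EReal) < y :=
  EReal.lt_iff_exists_rat_btwn.mp h

/-- If `t < tauLoc π q`, the persistent set is the whole support; balls of the support have positive
measure, which gives the reverse inequality. -/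
theorem smallUpperDim_eq_tauLoc {q : ℝ} {μ : ProbabilityMeasure π.support}
    (hpos : ∀ U : Set π.support, IsOpen U → U.Nonempty → 0 < (μ : Measure π.support) U)
    (hle : ∀ t : ℚ, ∀ B : Set π.support, MeasurableSet B →
      0 < (μ : Measure π.support) (B ∩ persistentSet π q t) →
      ((t : ℝ) : EReal) ≤ upperDim π q (Subtype.val '' B)) :
    smallUpperDim π q μ = tauLoc π q := by
  have hcoe : ∀ E : Set π.support, 0 < μ E ↔ 0 < (μ : Measure π.support) E := fun E => by
    rw [← ProbabilityMeasure.ennreal_coeFn_eq_coeFn_toMeasure, ENNReal.coe_pos]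
  refine le_antisymm ?_ ?_
  · refine le_iInf₂ fun x hx => le_iInf₂ fun r hr => ?_
    rw [← image_val_ball ⟨x, hx⟩ r]
    refine iInf_le_of_le _ (iInf_le_of_le Metric.isOpen_ball.measurableSet (iInf_le _ ?_))
    exact (hcoe _).mpr (hpos _ Metric.isOpen_ball ⟨_, Metric.mem_ball_self hr⟩)
  · refine le_iInf fun E => le_iInf₂ fun hE hμE => not_lt.mp fun hlt => ?_
    obtain ⟨t, ht1, ht2⟩ := exists_rat_between hlt
    have huniv : persistentSet π q t = Set.univ := by
      rw [persistentSet, interior_eq_univ, Set.eq_univ_iff_forall]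
      intro x r hr
      rw [image_val_ball]
      exact ht2.trans_le (iInf₂_le_of_le (x : EuclideanSpace ℝ (Fin d)) x.2 (iInf₂_le r hr))
    refine ht1.not_ge (hle t E hE ?_)
    rw [huniv, Set.inter_univ]
    exact (hcoe E).mp hμE

/-- For `t > tauLocMax π q` the thin set is dense, hence of full measure. Finitely many of the balls
that make it up carry almost all the mass, and their union still has dimension less than `t`. -/
theorem bigUpperDim_le_tauLocMax (hc : IsCompact π.support) {q : ℝ}
    {μ : ProbabilityMeasure π.support}
    (hnull : ∀ t : ℚ, Dense (thinSet π q t) → (μ : Measure π.support) (thinSet π q t)ᶜ = 0) :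
    bigUpperDim π q μ ≤ tauLocMax π q := by
  have : CompactSpace π.support := isCompact_iff_compactSpace.mp hc
  refine iSup₂_le fun ε hε => not_lt.mp fun hlt => ?_
  obtain ⟨t, ht1, ht2⟩ := exists_rat_between hlt
  have hdense : Dense (thinSet π q t) := by
    rw [← compl_compl (thinSet π q t), ← interior_eq_empty_iff_dense_compl]
    by_contra hne
    obtain ⟨y, hy⟩ := Set.nonempty_iff_ne_empty.mpr hne
    obtain ⟨ρ, hρ, hsub⟩ := Metric.isOpen_iff.mp isOpen_interior y hy
    refine ht1.not_ge (le_iSup₂_of_le (y : EuclideanSpace ℝ (Fin d)) y.2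
      (le_iSup₂_of_le ρ hρ ?_))
    refine le_iInf₂ fun x hx => le_iInf₂ fun r hr => ?_
    have hxy : dist x y < ρ := hx.2
    set r' := min r (ρ - dist x y)
    have hr' : 0 < r' := lt_min hr (by linarith)
    have hxρ : (⟨x, hx.1⟩ : π.support) ∈ Metric.ball y ρ := hxy
    have hx' : (⟨x, hx.1⟩ : π.support) ∈ (thinSet π q t)ᶜ := interior_subset (hsub hxρ)
    have h1 : ((t : ℝ) : EReal) ≤
        upperDim π q (Subtype.val '' Metric.ball (⟨x, hx.1⟩ : π.support) r') :=
      not_lt.mp fun h => hx' ⟨r', hr', h⟩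
    refine h1.trans (upperDim_mono q ?_)
    rw [image_val_ball]
    refine fun z hz => ⟨⟨hz.1, ?_⟩, Metric.ball_subset_ball (min_le_left _ _) hz.2⟩
    have hz2 : dist z x < r' := hz.2
    have h3 : r' ≤ ρ - dist x y := min_le_right _ _
    have h4 := dist_triangle z x y
    exact Metric.mem_ball.mpr (by linarith)
  have hfull : (μ : Measure π.support) (thinSet π q t) = 1 :=
    (prob_compl_eq_zero_iff (isOpen_thinSet q t).measurableSet).mp (hnull t hdense)
  have hlt1 : ENNReal.ofReal (1 - ε) < (μ : Measure π.support) (thinSet π q t) := by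
    rw [hfull, ← ENNReal.ofReal_one]
    exact (ENNReal.ofReal_lt_ofReal_iff one_pos).mpr (by linarith)
  obtain ⟨L, hL, hLc, hμL⟩ := (isOpen_thinSet q t).exists_lt_isCompact hlt1
  choose! ρ hρ0 hρ using fun (x : π.support) (hx : x ∈ thinSet π q t) => hx
  obtain ⟨F, hFL, hcov⟩ := hLc.elim_nhds_subcover (fun x => Metric.ball x (ρ x))
    (fun x hx => Metric.ball_mem_nhds x (hρ0 x (hL hx)))
  set E : Set π.support := ⋃ x ∈ F, Metric.ball x (ρ x) with hE
  have hEm : MeasurableSet E :=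
    (isOpen_biUnion fun _ _ => Metric.isOpen_ball).measurableSet
  have hEdim : upperDim π q (Subtype.val '' E) < ((t : ℝ) : EReal) := by
    rw [hE]
    simp only [Set.image_iUnion]
    exact upperDim_biUnion_lt q F _ fun x hx => hρ x (hL (hFL x hx))
  refine (ht2.trans_le (iInf_le_of_le E (iInf₂_le_of_le hEm ?_ le_rfl))).not_gt hEdim
  have h2 : ENNReal.ofReal (1 - ε) < ENNReal.ofReal (μ E : ℝ) := by
    rw [ENNReal.ofReal_coe_nnreal, ProbabilityMeasure.ennreal_coeFn_eq_coeFn_toMeasure]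
    exact hμL.trans_le (measure_mono hcov)
  exact (ENNReal.ofReal_lt_ofReal_iff'.mp h2).1

/-- If `t < tauLocMax π q`, some ball lies in the persistent set and has positive measure, so every
set of measure close enough to `1` meets it in positive measure. -/
theorem tauLocMax_le_bigUpperDim {q : ℝ} {μ : ProbabilityMeasure π.support}
    (hpos : ∀ U : Set π.support, IsOpen U → U.Nonempty → 0 < (μ : Measure π.support) U)
    (hle : ∀ t : ℚ, ∀ B : Set π.support, MeasurableSet B →
      0 < (μ : Measure π.support) (B ∩ persistentSet π q t) →
      ((t : ℝ) : EReal) ≤ upperDim π q (Subtype.val '' B)) :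
    tauLocMax π q ≤ bigUpperDim π q μ := by
  refine iSup₂_le fun y hy => iSup₂_le fun ρ hρ => not_lt.mp fun hlt => ?_
  obtain ⟨t, ht1, ht2⟩ := exists_rat_between hlt
  set V : Set π.support := Metric.ball ⟨y, hy⟩ ρ with hV
  have hVU : V ⊆ persistentSet π q t := by
    refine interior_maximal (fun x hx r hr => ?_) Metric.isOpen_ball
    refine ht2.trans_le (iInf₂_le_of_le (x : EuclideanSpace ℝ (Fin d)) ⟨x.2, hx⟩
      (iInf₂_le_of_le r hr (upperDim_mono q ?_)))
    rw [image_val_ball]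
    exact Set.inter_subset_inter_left _ Set.inter_subset_left
  have hVpos := hpos V Metric.isOpen_ball ⟨_, Metric.mem_ball_self hρ⟩
  have hVpos' : 0 < (μ : Measure π.support).real V :=
    ENNReal.toReal_pos hVpos.ne' (measure_ne_top _ _)
  refine ht1.not_ge (le_iSup₂_of_le _ hVpos' (le_iInf fun E => le_iInf₂ fun hE hμE => ?_))
  refine hle t E hE ((pos_iff_ne_zero.mpr fun h0 => ?_).trans_le
    (measure_mono (Set.inter_subset_inter_right E hVU)))
  have h1 := measureReal_union_add_inter (μ := (μ : Measure π.support)) (s := E)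
    (Metric.isOpen_ball.measurableSet : MeasurableSet V)
  have h2 : (μ : Measure π.support).real (E ∩ V) = 0 := by simp [Measure.real, h0]
  have h3 : (μ : Measure π.support).real (E ∪ V) ≤ 1 := measureReal_le_one
  have h4 : (μ E : ℝ) = (μ : Measure π.support).real E := rfl
  linarith

end Typical

/-! ### Dependence on the order -/

section Lipschitz

variable {d : ℕ} {π : Measure (EuclideanSpace ℝ (Fin d))}

theorem iInf_le_iInf_add {ι : Sort*} {f g : ι → EReal} {c : ℝ} (h : ∀ i, f i ≤ g i + c) :
    ⨅ i, f i ≤ (⨅ i, g i) + c := by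
  rw [← EReal.sub_le_iff_le_add (Or.inl (EReal.coe_ne_bot _)) (Or.inl (EReal.coe_ne_top _))]
  refine le_iInf fun i => ?_
  rw [EReal.sub_le_iff_le_add (Or.inl (EReal.coe_ne_bot _)) (Or.inl (EReal.coe_ne_top _))]
  exact (iInf_le f i).trans (h i)

theorem iSup_le_iSup_add {ι : Sort*} {f g : ι → EReal} {c : ℝ} (h : ∀ i, f i ≤ g i + c) :
    ⨆ i, f i ≤ (⨆ i, g i) + c :=
  iSup_le fun i => (h i).trans (add_le_add_left (le_iSup g i) _)

theorem localUpperDim_le_add {q q' c : ℝ}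
    (h : ∀ E : Set (EuclideanSpace ℝ (Fin d)), upperDim π q' E ≤ upperDim π q E + c)
    (F : Set (EuclideanSpace ℝ (Fin d))) :
    localUpperDim π q' F ≤ localUpperDim π q F + c :=
  iInf_le_iInf_add fun _ => iInf_le_iInf_add fun _ => iInf_le_iInf_add fun _ =>
    iInf_le_iInf_add fun _ => h _

theorem tauLocMax_le_add {q q' c : ℝ}
    (h : ∀ E : Set (EuclideanSpace ℝ (Fin d)), upperDim π q' E ≤ upperDim π q E + c) :
    tauLocMax π q' ≤ tauLocMax π q + c :=
  iSup_le_iSup_add fun _ => iSup_le_iSup_add fun _ => iSup_le_iSup_add fun _ =>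
    iSup_le_iSup_add fun _ => localUpperDim_le_add h _

theorem smallUpperDim_le_add {q q' c : ℝ}
    (h : ∀ E : Set (EuclideanSpace ℝ (Fin d)), upperDim π q' E ≤ upperDim π q E + c)
    (μ : ProbabilityMeasure π.support) :
    smallUpperDim π q' μ ≤ smallUpperDim π q μ + c :=
  iInf_le_iInf_add fun _ => iInf_le_iInf_add fun _ => iInf_le_iInf_add fun _ => h _

theorem bigUpperDim_le_add {q q' c : ℝ}
    (h : ∀ E : Set (EuclideanSpace ℝ (Fin d)), upperDim π q' E ≤ upperDim π q E + c)
    (μ : ProbabilityMeasure π.support) :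
    bigUpperDim π q' μ ≤ bigUpperDim π q μ + c :=
  iSup_le_iSup_add fun _ => iSup_le_iSup_add fun _ =>
    iInf_le_iInf_add fun _ => iInf_le_iInf_add fun _ => iInf_le_iInf_add fun _ => h _

/-- Lipschitz functions with extended real values are compared through rational arguments. -/
theorem le_of_forall_rat_le {s : ℝ} {f g : ℝ → EReal}
    (hf : ∀ q q' : ℝ, f q' ≤ f q + ((s * |q' - q| : ℝ) : EReal))
    (hg : ∀ q q' : ℝ, g q' ≤ g q + ((s * |q' - q| : ℝ) : EReal))
    (h : ∀ q : ℚ, f q ≤ g q) (q : ℝ) : f q ≤ g q := by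
  refine EReal.le_of_forall_lt_iff_le.mp fun z hz => ?_
  obtain ⟨z', hz', hzz⟩ := exists_real_between hz
  -- a rational `p` so close to `q` that passing from `q` to `p` and back stays below `z`
  have hcont : Tendsto (fun p : ℝ => z' + s * |p - q| + s * |q - p|) (𝓝 q) (𝓝 z') := by
    have : Continuous fun p : ℝ => z' + s * |p - q| + s * |q - p| := by fun_prop
    simpa using this.tendsto q
  obtain ⟨p, hp⟩ := Rat.isDenseEmbedding_coe_real.dense.exists_mem_open isOpen_interior
    ⟨q, mem_interior_iff_mem_nhds.mpr (hcont (Iio_mem_nhds hzz))⟩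
  have hp' := interior_subset hp
  change z' + s * |(p : ℝ) - q| + s * |q - p| < z at hp'
  calc f q ≤ f p + ((s * |q - p| : ℝ) : EReal) := hf p q
    _ ≤ (g q + ((s * |(p : ℝ) - q| : ℝ) : EReal)) + ((s * |q - p| : ℝ) : EReal) := by
        gcongr
        exact (h p).trans (hg q p)
    _ ≤ ((z' : EReal) + ((s * |(p : ℝ) - q| : ℝ) : EReal)) + ((s * |q - p| : ℝ) : EReal) := by
        gcongr
    _ ≤ z := by
        rw [← EReal.coe_add, ← EReal.coe_add]
        exact EReal.coe_le_coe_iff.mpr hp'.le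

end Lipschitz

end MultifractalBox

theorem mainTheorem1 (d : ℕ)
    (π : MeasureTheory.Measure (EuclideanSpace ℝ (Fin d)))
    [MeasureTheory.IsProbabilityMeasure π]
    (hdoubling : MultifractalBox.IsDoubling π)
    (hcompact : IsCompact π.support) :
    ∃ R : Set (MeasureTheory.ProbabilityMeasure π.support),
      IsGδ R ∧ Dense R ∧
        ∀ μ ∈ R, ∀ q : ℝ,
          MultifractalBox.smallUpperDim π q μ = MultifractalBox.tauLoc π q ∧
          MultifractalBox.bigUpperDim π q μ = MultifractalBox.tauLocMax π q := by
  have : CompactSpace π.support := isCompact_iff_compactSpace.mp hcompact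
  have hle : ∀ᶠ μ : ProbabilityMeasure π.support in residual _, ∀ (q t : ℚ) (B : Set π.support),
      MeasurableSet B →
      0 < (μ : Measure π.support) (B ∩ MultifractalBox.persistentSet π q t) →
      ((t : ℝ) : EReal) ≤ MultifractalBox.upperDim π q (Subtype.val '' B) := by
    simp only [eventually_countable_forall]
    exact fun q t => MultifractalBox.eventually_residual_le_upperDim hdoubling hcompact q t
  have hnull : ∀ᶠ μ : ProbabilityMeasure π.support in residual _, ∀ (q t : ℚ),
      Dense (MultifractalBox.thinSet π q t) →
      (μ : Measure π.support) (MultifractalBox.thinSet π q t)ᶜ = 0 := by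
    simp only [eventually_countable_forall]
    exact fun q t hd => MultifractalBox.eventually_residual_measure_compl_eq_zero
      (MultifractalBox.isOpen_thinSet q t) hd
  obtain ⟨R, hR, hRδ, hRd⟩ := mem_residual.mp
    ((MultifractalBox.eventually_residual_measure_pos (X := π.support)).and (hle.and hnull))
  refine ⟨R, hRδ, hRd, fun μ hμ => ?_⟩
  obtain ⟨h1, h2, h3⟩ := hR hμ
  obtain ⟨s, hs⟩ := hdoubling.exists_upperDim_le_add hcompact
  have hsmall := fun q q' => MultifractalBox.smallUpperDim_le_add (hs q q') μ
  have hbig := fun q q' => MultifractalBox.bigUpperDim_le_add (hs q q') μ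
  have htau : ∀ q q', MultifractalBox.tauLoc π q' ≤ MultifractalBox.tauLoc π q + _ :=
    fun q q' => MultifractalBox.localUpperDim_le_add (hs q q') π.support
  have htauMax := fun q q' => MultifractalBox.tauLocMax_le_add (hs q q')
  have hrat : ∀ q : ℚ, MultifractalBox.smallUpperDim π q μ = MultifractalBox.tauLoc π q :=
    fun q => MultifractalBox.smallUpperDim_eq_tauLoc h1 (h2 q)
  have hratMax : ∀ q : ℚ, MultifractalBox.bigUpperDim π q μ = MultifractalBox.tauLocMax π q :=
    fun q => le_antisymm (MultifractalBox.bigUpperDim_le_tauLocMax hcompact (h3 q))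
      (MultifractalBox.tauLocMax_le_bigUpperDim h1 (h2 q))
  exact fun q =>
    ⟨le_antisymm
      (MultifractalBox.le_of_forall_rat_le hsmall htau (fun p => (hrat p).le) q)
      (MultifractalBox.le_of_forall_rat_le htau hsmall (fun p => (hrat p).ge) q),
    le_antisymm
      (MultifractalBox.le_of_forall_rat_le hbig htauMax (fun p => (hratMax p).le) q)
      (MultifractalBox.le_of_forall_rat_le htauMax hbig (fun p => (hratMax p).ge) q)⟩
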